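/- Let $V$ be a countable set and $G$ a simple, undirected, locally finite graph with vertex set $V$. Let $\mathcal{A}_G$ be the closure in $\ell^2(V)$ of the symmetric operator $(\mathcal{A}_{G,\circ}f)(x)=\sum_{y\sim x}f(y)$, defined for finitely supported $f\colon V\to\mathbb{C}$, and let $\eta_\pm(\mathcal{A}_G)=\dim\ker\bigl((\mathcal{A}_G)^*\mp\mathrm{i}\bigr)\in\mathbb{N}\cup\{\infty\}$ be its deficiency indices. Theorem. For every $n\in\mathbb{N}\cup\{\infty\}$ (where $0\in\mathbb{N}$) there is a simple, locally finite graph $G$ on a countable vertex set such that $\eta_+(\mathcal{A}_G)=\eta_-(\mathcal{A}_G)=n$. -/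

import Mathlib

open scoped lp ENNReal InnerProductSpace LinearPMap

noncomputable section

/-- `dim ker (T* - z) ∈ ℕ ∪ {∞}`, for an operator `T` in a complex Hilbert space with adjoint `T*`
(the kernel is taken inside the domain of `T*`). -/
def adjointKernelDim {H : Type*} [NormedAddCommGroup H] [InnerProductSpace ℂ H] [CompleteSpace H]
    (T : H →ₗ.[ℂ] H) (z : ℂ) : ℕ∞ :=
  Cardinal.toENat (Module.rank ℂ (LinearMap.ker (T†.toFun - z • T†.domain.subtype)))

/-- The deficiency indices `(dim ker (T* - i), dim ker (T* + i))`. -/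
def deficiencyIndices {H : Type*} [NormedAddCommGroup H] [InnerProductSpace ℂ H] [CompleteSpace H]
    (T : H →ₗ.[ℂ] H) : ℕ∞ × ℕ∞ :=
  (adjointKernelDim T Complex.I, adjointKernelDim T (-Complex.I))

/-- The finitely supported functions, as a subspace of `ℓ²(V)`. -/
def finSupp (V : Type*) : Submodule ℂ ℓ²(V, ℂ) where
  carrier := {f | (Function.support (f : V → ℂ)).Finite}
  zero_mem' := (Set.finite_empty.subset fun _ h => h rfl)
  add_mem' := by
    intro f g hf hg
    exact (hf.union hg).subset (Function.support_add (f : V → ℂ) g)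
  smul_mem' := by
    intro c f hf
    exact Set.Finite.subset hf (Function.support_const_smul_subset c (f : V → ℂ))

namespace SimpleGraph

variable {V : Type*} (G : SimpleGraph V) [G.LocallyFinite]

theorem memlp_sum_neighbors (f : ℓ²(V, ℂ)) (hf : f ∈ finSupp V) :
    Memℓp (fun x => ∑ y ∈ G.neighborFinset x, (f : V → ℂ) y) 2 := by
  refine Memℓp.of_exponent_ge (memℓp_zero ?_) zero_le
  refine Set.Finite.subset (Set.Finite.biUnion hf fun y _ => (G.neighborSet y).toFinite) ?_
  intro x hx
  obtain ⟨y, hy, hne⟩ := Finset.exists_ne_zero_of_sum_ne_zero hx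
  exact Set.mem_biUnion (x := y) hne ((G.mem_neighborFinset x y).1 hy).symm

/-- The adjacency operator `(A f)(x) = ∑_{y ∼ x} f(y)` on the finitely supported functions. -/
def adjOpMin : ℓ²(V, ℂ) →ₗ.[ℂ] ℓ²(V, ℂ) where
  domain := finSupp V
  toFun :=
    { toFun := fun f => ⟨fun x => ∑ y ∈ G.neighborFinset x, (f : ℓ²(V, ℂ)) y,
        G.memlp_sum_neighbors f f.2⟩
      map_add' := by
        intro f g
        ext x
        exact Finset.sum_add_distrib
      map_smul' := by
        intro c f
        ext x
        exact (Finset.mul_sum _ _ _).symm }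

/-- The adjacency matrix of `G`: the closure of the operator on finitely supported functions. -/
def adjOp : ℓ²(V, ℂ) →ₗ.[ℂ] ℓ²(V, ℂ) := G.adjOpMin.closure

theorem adjOpMin_apply (f : G.adjOpMin.domain) (x : V) :
    (G.adjOpMin f : V → ℂ) x = ∑ y ∈ G.neighborFinset x, (f : ℓ²(V, ℂ)) y := rfl

/-! The operator is densely defined, symmetric and closable, so that adjoint and closure have
their usual meaning. -/

theorem dense_adjOpMin_domain : Dense (G.adjOpMin.domain : Set ℓ²(V, ℂ)) := by
  classical
  intro f
  refine mem_closure_of_tendsto (lp.hasSum_single (by norm_num) f) (.of_forall fun s => ?_)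
  refine Submodule.sum_mem _ fun i _ => ?_
  refine (Set.finite_singleton i).subset fun x hx => ?_
  by_contra h
  exact hx (by simp [lp.single_apply, show x ≠ i from h])

theorem adjOpMin_isFormalAdjoint : G.adjOpMin.IsFormalAdjoint G.adjOpMin := by
  classical
  intro f g
  have hf : (Function.support ((f : ℓ²(V, ℂ)) : V → ℂ)).Finite := f.2
  have hg : (Function.support ((g : ℓ²(V, ℂ)) : V → ℂ)).Finite := g.2
  obtain ⟨S, hS⟩ := (hf.union hg).exists_finset_coe
  have hfS : ∀ x, x ∉ S → (f : ℓ²(V, ℂ)) x = 0 := fun x hx => by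
    by_contra h
    exact hx (by rw [← Finset.mem_coe, hS]; exact Or.inl h)
  have hgS : ∀ x, x ∉ S → (g : ℓ²(V, ℂ)) x = 0 := fun x hx => by
    by_contra h
    exact hx (by rw [← Finset.mem_coe, hS]; exact Or.inr h)
  have key : ∀ (u : V → ℂ), (∀ x, x ∉ S → u x = 0) → ∀ x,
      ∑ y ∈ G.neighborFinset x, u y = ∑ y ∈ S, if G.Adj x y then u y else 0 := by
    intro u hu x
    rw [← Finset.sum_filter]
    refine (Finset.sum_subset (fun y hy => ?_) fun y hy hn => ?_).symm
    · simpa using (Finset.mem_filter.1 hy).2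
    · refine hu y fun h => hn (Finset.mem_filter.2 ⟨h, by simpa using hy⟩)
  rw [lp.inner_eq_tsum, lp.inner_eq_tsum, tsum_eq_sum (s := S), tsum_eq_sum (s := S)]
  · simp only [adjOpMin_apply, key _ hfS, key _ hgS, sum_inner, inner_sum]
    rw [Finset.sum_comm]
    refine Finset.sum_congr rfl fun x _ => Finset.sum_congr rfl fun y _ => ?_
    by_cases h : G.Adj x y
    · simp [h, h.symm]
    · simp [h, G.adj_comm y x]
  · intro x hx
    simp [hfS x hx]
  · intro x hx
    simp [hgS x hx]

theorem adjOpMin_isClosable : G.adjOpMin.IsClosable :=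
  (LinearPMap.adjoint_isClosed G.dense_adjOpMin_domain).isClosable.leIsClosable
    (G.adjOpMin_isFormalAdjoint.le_adjoint G.dense_adjOpMin_domain)

end SimpleGraph

end

open scoped lp ENNReal InnerProductSpace LinearPMap

noncomputable section

/-! Weakly, `ker (A* - z)` is the space of square-summable solutions of the eigenvalue equation, so
one has to count these at `z = ± i`. On the ray a solution has modulus a Fibonacci number times `‖f
0‖`, hence is never square-summable unless zero: this gives `n = 0`. On an antitree with spheres of
size `2 ^ k` and `z ≠ 0`, a solution is constant on spheres, so it is fixed by its root value. Its
sphere sums satisfy `s (k+2) = z * s (k+1) / 2 ^ (k+1) - s k` and, for `‖z‖ ≤ 1`, grow at most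
linearly, while its squared norm is `∑ ‖s k‖ ^ 2 / 2 ^ k`, which is finite. Each copy thus
contributes exactly one dimension, and `n` disjoint copies give `n`. -/

namespace SimpleGraph

/-! ### Deficiency spaces as spaces of square-summable eigenfunctions. -/

section Eigenspace

variable {V : Type*} (G : SimpleGraph V) [G.LocallyFinite]

/-- The square-summable solutions of the eigenvalue equation `∑_{y ∼ x} f(y) = z f(x)`. -/
def adjEigenspace (z : ℂ) : Submodule ℂ ℓ²(V, ℂ) where
  carrier := {f | ∀ x, ∑ y ∈ G.neighborFinset x, (f : V → ℂ) y = z * (f : V → ℂ) x}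
  zero_mem' := by simp
  add_mem' := by
    intro f g hf hg x
    simp only [lp.coeFn_add, Pi.add_apply, Finset.sum_add_distrib, hf x, hg x, mul_add]
  smul_mem' := by
    intro c f hf x
    simp only [lp.coeFn_smul, Pi.smul_apply, smul_eq_mul, ← Finset.mul_sum, hf x]
    ring

theorem mem_adjEigenspace {z : ℂ} {f : ℓ²(V, ℂ)} :
    f ∈ G.adjEigenspace z ↔ ∀ x, ∑ y ∈ G.neighborFinset x, f y = z * f x :=
  Iff.rfl

theorem single_mem_finSupp [DecidableEq V] (x : V) (c : ℂ) :
    (lp.single 2 x c : ℓ²(V, ℂ)) ∈ finSupp V := by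
  refine (Set.finite_singleton x).subset fun y hy => ?_
  by_contra h
  exact hy (by simp [lp.single_apply, show y ≠ x from h])

theorem adjOpMin_single [DecidableEq V] (x : V) (c : ℂ) :
    G.adjOpMin ⟨lp.single 2 x c, single_mem_finSupp x c⟩ =
      ∑ y ∈ G.neighborFinset x, (lp.single 2 y c : ℓ²(V, ℂ)) := by
  ext v
  rw [adjOpMin_apply, lp.coeFn_sum, Finset.sum_apply]
  simp only [lp.single_apply, Pi.single_apply, Finset.sum_ite_eq]
  rw [Finset.sum_ite_eq']
  have h : x ∈ G.neighborFinset v ↔ v ∈ G.neighborFinset x := by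
    rw [mem_neighborFinset, mem_neighborFinset, G.adj_comm]
  by_cases hv : v ∈ G.neighborFinset x
  · rw [if_pos hv, if_pos (h.2 hv)]
  · rw [if_neg hv, if_neg (mt h.1 hv)]

theorem inner_adjOpMin_single [DecidableEq V] (f : ℓ²(V, ℂ)) (x : V) (c : ℂ) :
    ⟪f, G.adjOpMin ⟨lp.single 2 x c, single_mem_finSupp x c⟩⟫_ℂ =
      c * starRingEnd ℂ (∑ y ∈ G.neighborFinset x, f y) := by
  rw [adjOpMin_single, inner_sum, map_sum, Finset.mul_sum]
  refine Finset.sum_congr rfl fun y _ => ?_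
  rw [lp.inner_single_right]
  rfl

/-- The eigenvalue equation, in weak form. -/
theorem mem_adjEigenspace_iff_inner {z : ℂ} {f : ℓ²(V, ℂ)} :
    f ∈ G.adjEigenspace z ↔
      ∀ g : G.adjOpMin.domain, ⟪z • f, (g : ℓ²(V, ℂ))⟫_ℂ = ⟪f, G.adjOpMin g⟫_ℂ := by
  classical
  have key : ∀ x c, ⟪z • f, (lp.single 2 x c : ℓ²(V, ℂ))⟫_ℂ = c * starRingEnd ℂ (z * f x) := by
    intro x c
    rw [lp.inner_single_right]
    rfl
  constructor
  · intro hf g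
    have hg : (Function.support ((g : ℓ²(V, ℂ)) : V → ℂ)).Finite := g.2
    -- A finitely supported `g` is a finite combination of point masses, so testing against these
    -- suffices.
    have hsum : g = ∑ x ∈ hg.toFinset,
        (⟨lp.single 2 x ((g : ℓ²(V, ℂ)) x), single_mem_finSupp x _⟩ : G.adjOpMin.domain) := by
      ext v
      rw [Submodule.coe_sum, lp.coeFn_sum, Finset.sum_apply]
      simp only [lp.single_apply, Pi.single_apply, Finset.sum_ite_eq]
      by_cases h : (g : ℓ²(V, ℂ)) v = 0 <;> simp [h]
    have hA : G.adjOpMin g = ∑ x ∈ hg.toFinset,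
        G.adjOpMin ⟨lp.single 2 x ((g : ℓ²(V, ℂ)) x), single_mem_finSupp x _⟩ := by
      conv_lhs => rw [hsum]
      exact map_sum G.adjOpMin.toFun _ _
    rw [hA, inner_sum]
    conv_lhs => rw [hsum]
    rw [Submodule.coe_sum, inner_sum]
    refine Finset.sum_congr rfl fun x _ => ?_
    rw [key, inner_adjOpMin_single, hf x]
  · intro h x
    have := h ⟨lp.single 2 x 1, single_mem_finSupp x 1⟩
    rw [key, inner_adjOpMin_single, one_mul, one_mul] at this
    exact ((starRingEnd ℂ).injective this).symm

theorem dense_adjOp_domain : Dense (G.adjOp.domain : Set ℓ²(V, ℂ)) :=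
  G.dense_adjOpMin_domain.mono G.adjOpMin.le_closure.1

/-- The identity cuts out a closed set of pairs, and by closability the graph of the closed operator
is the closure of the graph on finitely supported functions. -/
theorem inner_adjOp_of_mem_adjEigenspace {z : ℂ} {f : ℓ²(V, ℂ)} (hf : f ∈ G.adjEigenspace z)
    (g : G.adjOp.domain) : ⟪z • f, (g : ℓ²(V, ℂ))⟫_ℂ = ⟪f, G.adjOp g⟫_ℂ := by
  have hmem : ((g : ℓ²(V, ℂ)), G.adjOp g) ∈ closure (G.adjOpMin.graph : Set _) := by
    have h := G.adjOp.mem_graph g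
    have hc := G.adjOpMin_isClosable.graph_closure_eq_closure_graph
    have h' : ((g : ℓ²(V, ℂ)), G.adjOp g) ∈ G.adjOpMin.graph.topologicalClosure := by
      rw [hc]
      exact h
    exact h'
  have hclosed : IsClosed {p : ℓ²(V, ℂ) × ℓ²(V, ℂ) | ⟪z • f, p.1⟫_ℂ = ⟪f, p.2⟫_ℂ} :=
    isClosed_eq (by fun_prop) (by fun_prop)
  refine closure_minimal (fun p hp => ?_) hclosed hmem
  obtain ⟨u, hu1, hu2⟩ := (LinearPMap.mem_graph_iff _).1 hp
  have := G.mem_adjEigenspace_iff_inner.1 hf u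
  rwa [hu1, hu2] at this

/-- Membership in the domain of the adjoint is automatic for an eigenfunction: the weak equation
exhibits `z • f` as the value of the adjoint. -/
theorem map_ker_adjoint_adjOp (z : ℂ) :
    (LinearMap.ker (G.adjOp†.toFun - z • G.adjOp†.domain.subtype)).map
      G.adjOp†.domain.subtype = G.adjEigenspace z := by
  have hd := G.dense_adjOp_domain
  ext f
  simp only [Submodule.mem_map, LinearMap.mem_ker, LinearMap.sub_apply, LinearMap.smul_apply,
    Submodule.subtype_apply, sub_eq_zero]
  constructor
  · rintro ⟨u, hu, rfl⟩
    rw [mem_adjEigenspace_iff_inner]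
    intro g
    have hle := G.adjOpMin.le_closure
    have h := LinearPMap.adjoint_isFormalAdjoint hd u ⟨g, hle.1 g.2⟩
    have h2 : G.adjOpMin g = G.adjOp ⟨g, hle.1 g.2⟩ := hle.2 rfl
    rw [h2, ← h]
    exact congrArg (fun w => ⟪w, (g : ℓ²(V, ℂ))⟫_ℂ) hu.symm
  · intro hf
    have h := G.inner_adjOp_of_mem_adjEigenspace hf
    exact ⟨⟨f, LinearPMap.mem_adjoint_domain_of_exists f ⟨z • f, h⟩⟩,
      LinearPMap.adjoint_apply_eq hd _ h, rfl⟩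

theorem adjointKernelDim_adjOp (z : ℂ) :
    adjointKernelDim G.adjOp z = Cardinal.toENat (Module.rank ℂ (G.adjEigenspace z)) := by
  rw [adjointKernelDim, ← G.map_ker_adjoint_adjOp z]
  exact congrArg _ (Submodule.equivMapOfInjective _ (Submodule.subtype_injective _) _).rank_eq

end Eigenspace

/-! ### The ray: deficiency indices zero. -/

section Path

/-- The one-sided infinite path `0 ∼ 1 ∼ 2 ∼ ⋯`. -/
def rayGraph : SimpleGraph ℕ := hasse ℕ

theorem rayGraph_adj {k l : ℕ} : rayGraph.Adj k l ↔ k + 1 = l ∨ l + 1 = k := by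
  simp [rayGraph, hasse_adj, Nat.covBy_iff_add_one_eq]

theorem finite_neighborSet_rayGraph (k : ℕ) : (rayGraph.neighborSet k).Finite := by
  refine (Set.finite_Iic (k + 1)).subset fun l hl => ?_
  rw [mem_neighborSet, rayGraph_adj] at hl
  simp only [Set.mem_Iic]
  omega

instance : rayGraph.LocallyFinite := fun k => (finite_neighborSet_rayGraph k).fintype

theorem neighborFinset_rayGraph_zero : rayGraph.neighborFinset 0 = {1} := by
  ext l
  rw [mem_neighborFinset, rayGraph_adj, Finset.mem_singleton]
  omega

theorem neighborFinset_rayGraph_succ (k : ℕ) :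
    rayGraph.neighborFinset (k + 1) = {k, k + 2} := by
  ext l
  rw [mem_neighborFinset, rayGraph_adj, Finset.mem_insert, Finset.mem_singleton]
  omega

/-- The solutions of the eigenvalue equation at `z = ± i` on the ray grow like the Fibonacci
numbers. -/
theorem eq_fib_of_mem_adjEigenspace_rayGraph {z : ℂ} (hz : z ^ 2 = -1) {f : ℓ²(ℕ, ℂ)}
    (hf : f ∈ rayGraph.adjEigenspace z) (k : ℕ) : f k = z ^ k * Nat.fib (k + 1) * f 0 := by
  rw [mem_adjEigenspace] at hf
  induction k using Nat.twoStepInduction with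
  | zero => simp
  | one =>
    have := hf 0
    rw [neighborFinset_rayGraph_zero, Finset.sum_singleton] at this
    simp [this]
  | more k h1 h2 =>
    have := hf (k + 1)
    rw [neighborFinset_rayGraph_succ, Finset.sum_pair (by omega)] at this
    rw [eq_sub_of_add_eq' this, h1, h2, show k + 2 + 1 = (k + 1) + 2 from rfl,
      Nat.fib_add_two (n := k + 1)]
    push_cast
    -- Since `z ^ 2 = -1`, the minus sign in `f (k+2) = z * f (k+1) - f k` is absorbed into `z ^
    -- (k+2)`, leaving the Fibonacci addition.
    linear_combination (- z ^ k * f 0 * (Nat.fib (k + 1) : ℂ)) * hz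

/-- Here `‖z‖ = 1` and the Fibonacci factors are at least 1, so `‖f k‖ ≥ ‖f 0‖` for all `k`;
square-summability forces `f 0 = 0`. -/
theorem adjEigenspace_rayGraph {z : ℂ} (hz : z ^ 2 = -1) : rayGraph.adjEigenspace z = ⊥ := by
  rw [Submodule.eq_bot_iff]
  intro f hf
  have hfib := eq_fib_of_mem_adjEigenspace_rayGraph hz hf
  have hz1 : ‖z‖ = 1 := by
    have : ‖z‖ ^ 2 = 1 := by rw [← norm_pow, hz, norm_neg, norm_one]
    exact (pow_eq_one_iff_of_nonneg (norm_nonneg z) two_ne_zero).1 this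
  have hle : ∀ k, ‖f 0‖ ≤ ‖f k‖ := by
    intro k
    rw [hfib k, norm_mul, norm_mul, norm_pow, hz1, one_pow, one_mul, Complex.norm_natCast]
    exact le_mul_of_one_le_left (norm_nonneg _)
      (by exact_mod_cast Nat.fib_pos.2 k.succ_pos)
  have hsum : Summable fun k => ‖f k‖ ^ (2 : ℝ) := by
    simpa using (lp.memℓp f).summable (by norm_num)
  have h0 : ‖f 0‖ ^ (2 : ℝ) ≤ 0 := ge_of_tendsto' hsum.tendsto_atTop_zero fun k =>
    Real.rpow_le_rpow (norm_nonneg _) (hle k) (by norm_num)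
  have h0' : f 0 = 0 := by
    by_contra h
    exact absurd h0 (not_le.2 (Real.rpow_pos_of_pos (norm_pos_iff.2 h) _))
  ext k
  simp [hfib k, h0']

end Path

/-! ### Disjoint antitrees: one dimension per copy. -/

section Antitree

variable (ι : Type*)

/-- Disjoint copies, indexed by `ι`, of the antitree with spheres of size `2 ^ k`: each vertex in
the `k`-th sphere is joined to all vertices in the neighbouring spheres of the same copy. -/
def antitrees : SimpleGraph (ι × Σ k : ℕ, Fin (2 ^ k)) where
  Adj p q := p.1 = q.1 ∧ (p.2.1 + 1 = q.2.1 ∨ q.2.1 + 1 = p.2.1)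
  symm := ⟨fun _ _ h => ⟨h.1.symm, h.2.symm⟩⟩
  loopless := ⟨fun _ h => by have := h.2; omega⟩

variable {ι}

/-- The union of the spheres with radius in `s`, in the `i`-th copy of the antitree. -/
def antitreeSpheres (i : ι) (s : Finset ℕ) : Finset (ι × Σ k : ℕ, Fin (2 ^ k)) :=
  (s.sigma fun _ => Finset.univ).map ⟨Prod.mk i, Prod.mk_right_injective i⟩

theorem mem_antitreeSpheres {i : ι} {s : Finset ℕ} {p : ι × Σ k : ℕ, Fin (2 ^ k)} :
    p ∈ antitreeSpheres i s ↔ i = p.1 ∧ p.2.1 ∈ s := by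
  obtain ⟨j, k, a⟩ := p
  simp only [antitreeSpheres, Finset.mem_map, Finset.mem_sigma, Finset.mem_univ, and_true,
    Function.Embedding.coeFn_mk, Prod.mk.injEq]
  constructor
  · rintro ⟨q, hq, rfl, rfl⟩
    exact ⟨rfl, hq⟩
  · rintro ⟨rfl, h⟩
    exact ⟨⟨k, a⟩, h, rfl, rfl⟩

theorem sum_antitreeSpheres (i : ι) (s : Finset ℕ) (f : (ι × Σ k : ℕ, Fin (2 ^ k)) → ℂ) :
    ∑ p ∈ antitreeSpheres i s, f p = ∑ k ∈ s, ∑ a : Fin (2 ^ k), f (i, ⟨k, a⟩) := by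
  rw [antitreeSpheres, Finset.sum_map, Finset.sum_sigma]
  rfl

theorem finite_neighborSet_antitrees (p : ι × Σ k : ℕ, Fin (2 ^ k)) :
    ((antitrees ι).neighborSet p).Finite := by
  refine (antitreeSpheres p.1 (Finset.range (p.2.1 + 2))).finite_toSet.subset fun q hq => ?_
  rw [Finset.mem_coe, mem_antitreeSpheres, Finset.mem_range]
  have h : _ ∧ _ := hq
  exact ⟨h.1, by omega⟩

instance : (antitrees ι).LocallyFinite := fun p => (finite_neighborSet_antitrees p).fintype

theorem neighborFinset_antitrees_zero (i : ι) (a : Fin (2 ^ 0)) :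
    (antitrees ι).neighborFinset (i, ⟨0, a⟩) = antitreeSpheres i {1} := by
  ext q
  rw [mem_neighborFinset, mem_antitreeSpheres, Finset.mem_singleton]
  refine and_congr_right fun _ => ?_
  simp only
  omega

theorem neighborFinset_antitrees_succ (i : ι) (k : ℕ) (a : Fin (2 ^ (k + 1))) :
    (antitrees ι).neighborFinset (i, ⟨k + 1, a⟩) = antitreeSpheres i {k, k + 2} := by
  ext q
  rw [mem_neighborFinset, mem_antitreeSpheres, Finset.mem_insert, Finset.mem_singleton]
  refine and_congr_right fun _ => ?_
  simp only
  omega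

theorem mem_adjEigenspace_antitrees {z : ℂ} {f : ℓ²(ι × Σ k : ℕ, Fin (2 ^ k), ℂ)} :
    f ∈ (antitrees ι).adjEigenspace z ↔ ∀ i,
      (∀ a, ∑ b : Fin (2 ^ 1), f (i, ⟨1, b⟩) = z * f (i, ⟨0, a⟩)) ∧
      ∀ k a, ∑ b : Fin (2 ^ k), f (i, ⟨k, b⟩) + ∑ b : Fin (2 ^ (k + 2)), f (i, ⟨k + 2, b⟩) =
        z * f (i, ⟨k + 1, a⟩) := by
  have h0 : ∀ i a, ∑ y ∈ (antitrees ι).neighborFinset (i, ⟨0, a⟩), f y =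
      ∑ b : Fin (2 ^ 1), f (i, ⟨1, b⟩) := fun i a => by
    rw [neighborFinset_antitrees_zero, sum_antitreeSpheres, Finset.sum_singleton]
  have h1 : ∀ i k a, ∑ y ∈ (antitrees ι).neighborFinset (i, ⟨k + 1, a⟩), f y =
      ∑ b : Fin (2 ^ k), f (i, ⟨k, b⟩) + ∑ b : Fin (2 ^ (k + 2)), f (i, ⟨k + 2, b⟩) :=
    fun i k a => by
      rw [neighborFinset_antitrees_succ, sum_antitreeSpheres, Finset.sum_pair (by omega)]
  rw [mem_adjEigenspace]
  constructor
  · intro h i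
    exact ⟨fun a => by rw [← h, h0], fun k a => by rw [← h, h1]⟩
  · rintro h ⟨i, k, a⟩
    cases k with
    | zero => rw [h0, (h i).1 a]
    | succ k => rw [h1, (h i).2 k a]

/-- The neighbour sum depends only on the sphere, so `z ≠ 0` makes `f` constant on spheres. A
vanishing sphere sum then kills the whole sphere, and the recurrence carries the zero outward from
the root. -/
theorem eq_zero_of_mem_adjEigenspace_antitrees {z : ℂ} (hz : z ≠ 0)
    {f : ℓ²(ι × Σ k : ℕ, Fin (2 ^ k), ℂ)} (hf : f ∈ (antitrees ι).adjEigenspace z) {i : ι}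
    (h0 : f (i, ⟨0, 0⟩) = 0) (k : ℕ) : ∀ a, f (i, ⟨k, a⟩) = 0 := by
  obtain ⟨hf0, hf1⟩ := mem_adjEigenspace_antitrees.1 hf i
  have hconst : ∀ k (a b : Fin (2 ^ k)), f (i, ⟨k, a⟩) = f (i, ⟨k, b⟩) := by
    intro k a b
    refine mul_left_cancel₀ hz ?_
    cases k with
    | zero => rw [← hf0 a, ← hf0 b]
    | succ k => rw [← hf1 k a, ← hf1 k b]
  have hsum : ∀ k, ∑ b : Fin (2 ^ k), f (i, ⟨k, b⟩) = 0 → ∀ a, f (i, ⟨k, a⟩) = 0 := by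
    intro k h a
    rw [Finset.sum_congr rfl fun b _ => hconst k b a, Finset.sum_const] at h
    simpa using h
  induction k using Nat.twoStepInduction with
  | zero => exact fun a => (hconst 0 a 0).trans h0
  | one => exact hsum 1 (by rw [hf0 0, h0, mul_zero])
  | more k h1 h2 =>
    refine hsum (k + 2) ?_
    have := hf1 k 0
    rwa [h2, mul_zero, Finset.sum_eq_zero fun b _ => h1 b, zero_add] at this

/-- The radial solution of the eigenvalue equation on the antitree, times the sphere size. -/
def antitreeSeq (z : ℂ) : ℕ → ℂ
  | 0 => 1
  | 1 => z
  | k + 2 => z * antitreeSeq z (k + 1) / 2 ^ (k + 1) - antitreeSeq z k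

/-- The recurrence perturbs `s (k+2) = - s k` by a term of norm at most `(k+2) / 2 ^ (k+1) ≤ 1`, so
the norm gains at most 1 in two steps. -/
theorem norm_antitreeSeq_le {z : ℂ} (hz : ‖z‖ ≤ 1) (k : ℕ) : ‖antitreeSeq z k‖ ≤ k + 1 := by
  induction k using Nat.twoStepInduction with
  | zero => simp [antitreeSeq]
  | one => 
    rw [antitreeSeq, Nat.cast_one, one_add_one_eq_two]
    exact hz.trans one_le_two
  | more k h1 h2 =>
    rw [antitreeSeq]
    have hp : ((k + 1 : ℕ) : ℝ) + 1 ≤ 2 ^ (k + 1) := by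
      exact_mod_cast Nat.lt_two_pow_self (n := k + 1)
    have h3 : ‖z * antitreeSeq z (k + 1) / 2 ^ (k + 1)‖ ≤ 1 := by
      rw [norm_div, norm_mul, norm_pow, RCLike.norm_ofNat, div_le_one (by positivity)]
      exact (mul_le_of_le_one_left (norm_nonneg _) hz).trans (h2.trans hp)
    refine (norm_sub_le _ _).trans ?_
    push_cast
    linarith

open Classical in
/-- The radial solution of the eigenvalue equation, on the `i`-th copy of the antitree. -/
def antitreeSolution (z : ℂ) (i : ι) (p : ι × Σ k : ℕ, Fin (2 ^ k)) : ℂ :=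
  if p.1 = i then antitreeSeq z p.2.1 / 2 ^ p.2.1 else 0

/-- The summand is the squared norm carried by the `k`-th sphere: `2 ^ k` vertices, each with value
`s k / 2 ^ k`. -/
theorem summable_norm_antitreeSeq {z : ℂ} (hz : ‖z‖ ≤ 1) :
    Summable fun k : ℕ => ‖antitreeSeq z k‖ ^ 2 * (1 / 2) ^ k := by
  have hg : Summable fun k : ℕ => 4 * ((k : ℝ) ^ 2 * (1 / 2) ^ k) + 4 * (1 / 2) ^ k :=
    ((summable_pow_mul_geometric_of_norm_lt_one (R := ℝ) 2 (r := 1 / 2) (by norm_num)).mul_left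
      4).add (summable_geometric_two.mul_left 4)
  refine hg.of_nonneg_of_le (fun k => by positivity) fun k => ?_
  have h1 : ‖antitreeSeq z k‖ ^ 2 ≤ 4 * (k : ℝ) ^ 2 + 4 := by
    have := pow_le_pow_left₀ (norm_nonneg _) (norm_antitreeSeq_le hz k) 2
    nlinarith [sq_nonneg ((k : ℝ) - 1)]
  calc _ ≤ (4 * (k : ℝ) ^ 2 + 4) * (1 / 2) ^ k := by gcongr
    _ = _ := by ring

theorem memℓp_antitreeSolution {z : ℂ} (hz : ‖z‖ ≤ 1) (i : ι) :
    Memℓp (antitreeSolution z i) 2 := by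
  refine memℓp_gen ?_
  simp only [ENNReal.toReal_ofNat, Real.rpow_ofNat]
  -- The function vanishes off the `i`-th copy, so only that copy has to be summed.
  rw [← (Prod.mk_right_injective i).summable_iff]
  · have hform : (fun p => ‖antitreeSolution z i p‖ ^ 2) ∘ Prod.mk i =
        fun q : Σ k : ℕ, Fin (2 ^ k) => (‖antitreeSeq z q.1‖ / 2 ^ q.1) ^ 2 := by
      ext q
      simp [antitreeSolution]
    rw [hform, summable_sigma_of_nonneg fun _ => by positivity]
    refine ⟨fun _ => Summable.of_finite, ?_⟩
    refine (summable_norm_antitreeSeq hz).congr fun k => ?_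
    rw [tsum_fintype]
    dsimp only
    rw [Finset.sum_const, Finset.card_univ, Fintype.card_fin, nsmul_eq_mul]
    push_cast
    rw [one_div, inv_pow]
    field_simp
  · rintro ⟨j, q⟩ hj
    have : j ≠ i := fun h => hj ⟨q, by rw [h]⟩
    simp [antitreeSolution, this]

theorem antitreeSolution_mem_adjEigenspace {z : ℂ} (hz : ‖z‖ ≤ 1) (i : ι) :
    (⟨antitreeSolution z i, memℓp_antitreeSolution hz i⟩ : ℓ²(ι × Σ k : ℕ, Fin (2 ^ k), ℂ)) ∈
      (antitrees ι).adjEigenspace z := by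
  rw [mem_adjEigenspace_antitrees]
  intro j
  by_cases hj : j = i
  · subst hj
    constructor
    · intro a
      simp [antitreeSolution, antitreeSeq]
      ring
    · intro k a
      simp [antitreeSolution, antitreeSeq]
      field_simp
      ring
  · simp [antitreeSolution, hj]

/-- Evaluation of the solutions of the eigenvalue equation at the roots of the antitrees. -/
def evalRoots (ι : Type*) (z : ℂ) : (antitrees ι).adjEigenspace z →ₗ[ℂ] (ι → ℂ) where
  toFun f i := (f : ℓ²(ι × Σ k : ℕ, Fin (2 ^ k), ℂ)) (i, ⟨0, 0⟩)
  map_add' _ _ := rfl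
  map_smul' _ _ := rfl

theorem evalRoots_injective {z : ℂ} (hz : z ≠ 0) : Function.Injective (evalRoots ι z) := by
  rw [← LinearMap.ker_eq_bot, LinearMap.ker_eq_bot']
  intro f hf
  ext ⟨i, k, a⟩
  exact eq_zero_of_mem_adjEigenspace_antitrees hz f.2 (congrFun hf i) k a

/-- The root values of these solutions are the standard unit vectors, because `antitreeSeq z 0 = 1`.
-/
theorem linearIndependent_antitreeSolution {z : ℂ} (hz : ‖z‖ ≤ 1) :
    LinearIndependent ℂ fun i : ι =>
      (⟨_, antitreeSolution_mem_adjEigenspace hz i⟩ : (antitrees ι).adjEigenspace z) := by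
  classical
  refine LinearIndependent.of_comp (evalRoots ι z) ?_
  convert Pi.linearIndependent_single_one ι ℂ using 1
  ext i j
  change antitreeSolution z i (j, ⟨0, 0⟩) = _
  simp [antitreeSolution, antitreeSeq, Pi.single_apply]

theorem adjointKernelDim_antitrees {z : ℂ} (hz : ‖z‖ = 1) (ι : Type) :
    adjointKernelDim (antitrees ι).adjOp z = ENat.card ι := by
  rw [adjointKernelDim_adjOp, ENat.card]
  have hle := (linearIndependent_antitreeSolution (ι := ι) hz.le).cardinal_le_rank
  cases finite_or_infinite ι
  · have := Fintype.ofFinite ι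
    congr 1
    refine le_antisymm ?_ hle
    have hz0 : z ≠ 0 := norm_ne_zero_iff.1 (by rw [hz]; exact one_ne_zero)
    refine ((evalRoots ι z).rank_le_of_injective (evalRoots_injective hz0)).trans ?_
    rw [rank_fun', Cardinal.mk_fintype]
  -- For infinite `ι` the lower bound alone suffices, as `Cardinal.toENat` sends every infinite
  -- cardinal to `⊤`.
  · rw [Cardinal.toENat_eq_top.2 (Cardinal.aleph0_le_mk ι),
      Cardinal.toENat_eq_top.2 ((Cardinal.aleph0_le_mk ι).trans hle)]

end Antitree

end SimpleGraph

end

theorem theorem1 (n : ℕ∞) :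
    ∃ (V : Type) (_ : Countable V) (G : SimpleGraph V) (_ : G.LocallyFinite),
      deficiencyIndices G.adjOp = (n, n) := by
  have hunion : ∀ (ι : Type) [Countable ι], ENat.card ι = n →
      ∃ (V : Type) (_ : Countable V) (G : SimpleGraph V) (_ : G.LocallyFinite),
        deficiencyIndices G.adjOp = (n, n) := by
    intro ι _ hι
    refine ⟨_, inferInstance, SimpleGraph.antitrees ι, inferInstance, ?_⟩
    rw [deficiencyIndices, SimpleGraph.adjointKernelDim_antitrees (by simp),
      SimpleGraph.adjointKernelDim_antitrees (by simp), hι]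
  -- The union of zero antitrees would have an empty vertex set; the ray gives a nonempty example
  -- for `n = 0`.
  by_cases h0 : n = 0
  · refine ⟨ℕ, inferInstance, SimpleGraph.rayGraph, inferInstance, ?_⟩
    rw [deficiencyIndices, SimpleGraph.adjointKernelDim_adjOp,
      SimpleGraph.adjointKernelDim_adjOp, SimpleGraph.adjEigenspace_rayGraph (by simp),
      SimpleGraph.adjEigenspace_rayGraph (by simp), h0]
    simp
  · induction n with
    | top => exact hunion ℕ (by simp)
    | coe m => exact hunion (Fin m) (by simp)
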